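/- Let $k\ge 2$. Consider the infinite rooted $k$-ary tree: the root is $v_0$, every vertex $v_i$ has exactly $k$ children $v_{ki+1},\dots,v_{ki+k}$ (listed from left to right), and the root carries a self-loop, so that it counts as its own parent. For $\ell\ge 1$ let $N_{k,\ell}=\frac{k^\ell-1}{k-1}$, and place chips labeled $1,2,\dots,N_{k,\ell}$ on the root. A vertex carrying at least $k+1$ chips may fire: any $k+1$ of its chips are chosen, the $\lceil\frac{k+1}{2}\rceil$-th smallest of them is sent to the parent, and, of the remaining $k$ chips, the $i$-th smallest is sent to the $i$-th leftmost child for $i=1,\dots,k$. A configuration (the assignment of every labeled chip to a vertex) is stable if no vertex can fire. Let $Z_{k,\ell}$ be the number of distinct stable configurations that can be reached from the initial configuration by finite sequences of firings. For $j\ge 3$ put $$\eta_{k,j}=\sum_{i=0}^{\lfloor k/2\rfloor}\binom{(N_{k,j}-1)\frac{\lfloor k/2\rfloor}{k}-1-\lfloor \frac k2\rfloor}{i}\binom{(N_{k,j}-1)\frac{\lceil k/2\rceil}{k}-1-2\lceil \frac k2\rceil+i}{i}.$$ Then for all $k\ge 2$ and $\ell\ge 3$, $$Z_{k,\ell}\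 \ge\ \prod_{j=3}^{\ell}\eta_{k,j}^{\,k^{\ell-j}}.$$ -/

import Mathlib

namespace ChipFiring

/-- `N_{k,ℓ} = (k^ℓ - 1)/(k - 1)`; for `k ≥ 2` the division is exact. -/
def numChips (k l : ℕ) : ℕ := (k ^ l - 1) / (k - 1)

/-- The `j`-th leftmost child (`1 ≤ j ≤ k`) of vertex `v` of the infinite `k`-ary tree.
Vertices are indexed by `ℕ` in breadth-first order, the root being `0`. -/
def child (k v j : ℕ) : ℕ := k * v + j

/-- The parent of a vertex. The self-loop makes the root its own parent. -/
def parent (k v : ℕ) : ℕ := if v = 0 then 0 else (v - 1) / k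

/-- A configuration of `n` labeled chips records the vertex on which each chip lies.
The element `c : Fin n` stands for the chip with label `c + 1`. -/
abbrev Config (n : ℕ) : Type := Fin n → ℕ

/-- The vertex that receives the chip of rank `i` (`i = 0` for the smallest, `i = k` for the
largest) when `v` fires `k + 1` chips. The `⌈(k+1)/2⌉`-th smallest one, which has rank `k / 2`,
goes to the parent; the `j`-th smallest of the other `k` chips goes to the `j`-th child. -/
def target (k v i : ℕ) : ℕ :=
  if i = k / 2 then parent k v
  else if i < k / 2 then child k v (i + 1)
  else child k v i

/-- The tuple `t` of `k + 1` distinct chips, listed in increasing order, lies entirely on `v`. -/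
def LiesOn {n : ℕ} (k : ℕ) (c : Config n) (v : ℕ) (t : Fin (k + 1) ↪o Fin n) : Prop :=
  ∀ i, c (t i) = v

/-- `v` can fire in `c`: one can choose `k + 1` chips on it. -/
def CanFire {n : ℕ} (k : ℕ) (c : Config n) (v : ℕ) : Prop :=
  ∃ t : Fin (k + 1) ↪o Fin n, LiesOn k c v t

/-- One labeled firing: some vertex `v` fires some `k + 1` chips lying on it, and all other
chips stay where they are. -/
def Fires {n : ℕ} (k : ℕ) (c c' : Config n) : Prop :=
  ∃ (v : ℕ) (t : Fin (k + 1) ↪o Fin n), LiesOn k c v t ∧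
    (∀ i : Fin (k + 1), c' (t i) = target k v i) ∧
    (∀ x : Fin n, x ∉ Set.range t → c' x = c x)

/-- A configuration is stable if no vertex can fire. -/
def Stable {n : ℕ} (k : ℕ) (c : Config n) : Prop := ∀ v, ¬ CanFire k c v

/-- All chips on the root. -/
def initial (n : ℕ) : Config n := fun _ => 0

/-- The stable configurations of `n` labeled chips that some finite sequence of firings reaches
from the configuration with all chips on the root. -/
def stableConfigs (k n : ℕ) : Set (Config n) :=
  {c | Relation.ReflTransGen (Fires k) (initial n) c ∧ Stable k c}

/-- `Z_{k,ℓ}`: the number of possible stable configurations with `N_{k,ℓ}` chips at the root. -/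
noncomputable def Z (k l : ℕ) : ℕ := (stableConfigs k (numChips k l)).ncard

/-- `η_{k,j}`. Here `k / 2 = ⌊k/2⌋` and `(k + 1) / 2 = ⌈k/2⌉`. For `k ≥ 2` the divisions by `k`
are exact, because `k` divides `N_{k,j} - 1`, and for `j ≥ 3` no subtraction truncates. -/
def eta (k j : ℕ) : ℕ :=
  ∑ i ∈ Finset.range (k / 2 + 1),
    Nat.choose ((numChips k j - 1) * (k / 2) / k - 1 - k / 2) i *
    Nat.choose ((numChips k j - 1) * ((k + 1) / 2) / k - 1 - 2 * ((k + 1) / 2) + i) i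

end ChipFiring

/-! Put N = N_{k,ℓ-1}, so that there are kN + 1 chips. Let the root fire N times, leaving N chips on
each child and one on the root. From then on the k subtrees can be played as k independent copies of
the game with N chips. The one discrepancy is that a child of the root sends its median to the root
instead of keeping it. To repair this, let all k children fire once and then fire the k medians
together with the root's own chip. If these k + 1 chips are ordered by subtree, with the root's chip
in the middle (`MediansOrdered`), every median returns to its own child and the self-loops have been
simulated (`firesAt_zero_graft`). All subtrees must fire their roots equally often, so the induction
counts stable configurations reached with one fixed number of root firings (`stableAfter`). Each
step multiplies the number of admissible distributions by the k-th power of the previous count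
(`admissible_mul_pow_le`).

It remains to find η admissible distributions. Let h = ⌊k/2⌋, H = ⌈k/2⌉, n = N - 2, and number the
chips from 0. Chip A = h(n+2) stays on the root; by default the h left children get the chips below
A and the H right children those above. Choose i ≤ h, and exchange i chips X below A with i chips Y
above A. Two firings hand out X, Y and other extreme chips, which lie too near the ends of their
groups to be medians later (harmless exceptions occur if h = 1 or H = 1). The other n firings use
the median A and hand out consecutive blocks of what is left, so possible medians are ordered by
group. T is chosen so that (A, T] holds exactly Y and the Hn chips of the right blocks. The
distribution determines X and Y, and η counts the triples (i, X, Y). -/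

namespace ChipFiring

/-! ### Finiteness of the set of reachable stable configurations -/

section

variable {n : ℕ}

/-- A firing of the vertex `v`. -/
def FiresAt (k v : ℕ) (c c' : Config n) : Prop :=
  ∃ t : Fin (k + 1) ↪o Fin n, LiesOn k c v t ∧
    (∀ i : Fin (k + 1), c' (t i) = target k v i) ∧
    (∀ x : Fin n, x ∉ Set.range t → c' x = c x)

theorem FiresAt.fires {k v : ℕ} {c c' : Config n} (h : FiresAt k v c c') : Fires k c c' :=
  ⟨v, h⟩

/-- The rank of the chip that a firing sends to the parent. -/
def mid (k : ℕ) : Fin (k + 1) := ⟨k / 2, by omega⟩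

theorem target_mid (k v : ℕ) : target k v (mid k) = parent k v := by
  simp [target, mid]

theorem target_succAbove (k v : ℕ) (p : Fin k) :
    target k v ((mid k).succAbove p) = child k v (p + 1) := by
  by_cases h : (p : ℕ) < k / 2
  · rw [Fin.succAbove_of_castSucc_lt _ _ (by simpa [mid, Fin.lt_def] using h)]
    simp [target, h, h.ne]
  · rw [Fin.succAbove_of_le_castSucc _ _ (by simpa [mid, Fin.le_def] using h)]
    have h1 : (p : ℕ) + 1 ≠ k / 2 := by omega
    have h2 : ¬ ((p : ℕ) + 1 < k / 2) := by omega
    simp [target, h1, h2]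

theorem eq_mid_or_succAbove {k : ℕ} (i : Fin (k + 1)) :
    i = mid k ∨ ∃ p : Fin k, i = (mid k).succAbove p :=
  Fin.eq_self_or_eq_succAbove _ _

theorem child_ne_zero (k v j : ℕ) : child k v (j + 1) ≠ 0 := by simp [child]

theorem parent_zero (k : ℕ) : parent k 0 = 0 := by simp [parent]

theorem parent_child {k : ℕ} (v : ℕ) {j : ℕ} (hj : j < k) :
    parent k (child k v (j + 1)) = v := by
  rw [parent, if_neg (child_ne_zero k v j), child, ← add_assoc, Nat.add_sub_cancel,
    Nat.mul_add_div (by omega), Nat.div_eq_of_lt hj, add_zero]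

theorem exists_child {k w : ℕ} (hk : 0 < k) (hw : w ≠ 0) :
    ∃ p : Fin k, w = child k (parent k w) (p + 1) := by
  refine ⟨⟨(w - 1) % k, Nat.mod_lt _ hk⟩, ?_⟩
  have := Nat.div_add_mod (w - 1) k
  simp only [parent, if_neg hw, child]
  omega

theorem child_injective (k v : ℕ) {i j : ℕ} (h : child k v i = child k v j) : i = j := by
  simpa [child] using h

theorem lt_child {k : ℕ} (hk : 0 < k) (v j : ℕ) : v < child k v (j + 1) := by
  simp only [child]; nlinarith [Nat.le_mul_of_pos_left v hk]

/-- A bound for the vertices in a subtree that contains the root and has `m` edges. -/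
def vertexBound (k : ℕ) : ℕ → ℕ
  | 0 => 0
  | m + 1 => k * vertexBound k m + k

theorem vertexBound_mono {k : ℕ} (hk : 0 < k) : Monotone (vertexBound k) :=
  monotone_nat_of_le_succ fun m => by
    simp only [vertexBound]; nlinarith [Nat.le_mul_of_pos_left (vertexBound k m) hk]

/-- The edges used so far (each given by its lower end) form a subtree `T` with the root, and
carry distinct chips, each of them on an end of its edge. -/
def EdgesCarryChips (k : ℕ) (c : Config n) : Prop :=
  ∃ (T : Finset ℕ) (o : ℕ → Fin n), Set.InjOn o T ∧ 0 ∉ T ∧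
    (∀ w ∈ T, c (o w) = w ∨ c (o w) = parent k w) ∧
    (∀ x, c x ≠ 0 → c x ∈ T) ∧ (∀ w ∈ T, parent k w ≠ 0 → parent k w ∈ T) ∧
    ∀ w ∈ T, w ≤ vertexBound k T.card

theorem edgesCarryChips_initial (k : ℕ) [NeZero n] : EdgesCarryChips k (initial n) :=
  ⟨∅, fun _ => 0, by simp [initial]⟩

-- When v fires, the chips sent down become the chips of the edges to the children of v, and the
-- median becomes the chip of the edge above v. Every other edge keeps its chip.
open Classical in
theorem EdgesCarryChips.step {k : ℕ} (hk : 0 < k) {c c' : Config n}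
    (h : EdgesCarryChips k c) (hf : Fires k c c') : EdgesCarryChips k c' := by
  obtain ⟨T, o, hinj, h0, ho, hocc, hpar, hbd⟩ := h
  obtain ⟨v, t, ht, htar, hrest⟩ := hf
  have hv : v ≠ 0 → v ∈ T := fun hv => by
    have := hocc (t (mid k)); rw [ht] at this; exact this hv
  set C : Finset ℕ := Finset.univ.image (fun p : Fin k => child k v (p + 1)) with hC
  have hmemC : ∀ w, w ∈ C ↔ ∃ p : Fin k, child k v (p + 1) = w := by simp [hC]
  let o' : ℕ → Fin n := fun w =>
    if hp : ∃ p : Fin k, child k v (p + 1) = w then t ((mid k).succAbove hp.choose)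
    else if w = v then t (mid k) else o w
  have ho'c : ∀ p : Fin k, o' (child k v (p + 1)) = t ((mid k).succAbove p) := by
    intro p
    have hp : ∃ q : Fin k, child k v (q + 1) = child k v (p + 1) := ⟨p, rfl⟩
    have : hp.choose = p := by
      have := child_injective _ _ hp.choose_spec
      exact Fin.ext (by omega)
    simp only [o', dif_pos hp, this]
  have hvC : v ∉ C := by
    rw [hmemC]; rintro ⟨p, hp⟩; exact (lt_child hk v p).ne' hp
  have ho'v : o' v = t (mid k) := by
    have := hvC; rw [hmemC] at this
    simp only [o', dif_neg this, if_true]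
  have ho'o : ∀ w, w ∉ C → w ≠ v → o' w = o w := by
    intro w h1 h2; rw [hmemC] at h1
    simp only [o', dif_neg h1, if_neg h2]
  -- A fired chip lies on v, so an edge that owned it has v as an end; all such edges receive new
  -- chips.
  have hout : ∀ w ∈ T, w ∉ C → w ≠ v → o w ∉ Set.range t := by
    rintro w hw h1 h2 ⟨i, hi⟩
    have h3 := ht i
    rw [hi] at h3
    rcases ho w hw with h4 | h4
    · exact h2 (h4.symm.trans h3)
    · obtain ⟨p, hp⟩ := exists_child hk (w := w) (by rintro rfl; exact h0 hw)
      exact h1 ((hmemC w).2 ⟨p, by rw [hp, ← h4, h3]⟩)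
  have hcases : ∀ w ∈ T ∪ C, (∃ p : Fin k, w = child k v (p + 1)) ∨ (w = v ∧ v ≠ 0) ∨
      (w ∈ T ∧ w ∉ C ∧ w ≠ v) := by
    intro w hw
    by_cases h1 : w ∈ C
    · obtain ⟨p, hp⟩ := (hmemC w).1 h1
      exact Or.inl ⟨p, hp.symm⟩
    · have hwT : w ∈ T := by simpa [h1] using hw
      by_cases h2 : w = v
      · exact Or.inr (Or.inl ⟨h2, by rintro rfl; subst h2; exact h0 hwT⟩)
      · exact Or.inr (Or.inr ⟨hwT, h1, h2⟩)
  have hvb : v ≤ vertexBound k T.card := by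
    by_cases h1 : v = 0
    · omega
    · exact hbd v (hv h1)
  refine ⟨T ∪ C, o', ?_, ?_, ?_, ?_, ?_, ?_⟩
  · intro w hw w' hw' he
    rcases hcases w hw with ⟨p, rfl⟩ | ⟨rfl, h1⟩ | ⟨h1, h2, h3⟩ <;>
      rcases hcases w' hw' with ⟨p', rfl⟩ | ⟨rfl, h1'⟩ | ⟨h1', h2', h3'⟩
    · rw [ho'c, ho'c] at he
      have := Fin.succAbove_right_injective (t.injective he)
      rw [this]
    · rw [ho'c, ho'v] at he
      exact absurd (t.injective he) (Fin.succAbove_ne _ _)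
    · rw [ho'c, ho'o _ h2' h3'] at he
      exact absurd ⟨_, he⟩ (hout _ h1' h2' h3')
    · rw [ho'c, ho'v] at he
      exact absurd (t.injective he).symm (Fin.succAbove_ne _ _)
    · rfl
    · rw [ho'v, ho'o _ h2' h3'] at he
      exact absurd ⟨_, he⟩ (hout _ h1' h2' h3')
    · rw [ho'c, ho'o _ h2 h3] at he
      exact absurd ⟨_, he.symm⟩ (hout _ h1 h2 h3)
    · rw [ho'v, ho'o _ h2 h3] at he
      exact absurd ⟨_, he.symm⟩ (hout _ h1 h2 h3)
    · rw [ho'o _ h2 h3, ho'o _ h2' h3'] at he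
      exact hinj h1 h1' he
  · simp only [Finset.mem_union, h0, false_or, hmemC, not_exists]
    exact fun p => child_ne_zero k v p
  · intro w hw
    rcases hcases w hw with ⟨p, rfl⟩ | ⟨rfl, h1⟩ | ⟨h1, h2, h3⟩
    · left; rw [ho'c, htar, target_succAbove]
    · right; rw [ho'v, htar, target_mid]
    · rw [ho'o _ h2 h3, hrest _ (hout _ h1 h2 h3)]
      exact ho w h1
  · intro x hx
    by_cases hxt : x ∈ Set.range t
    · obtain ⟨i, rfl⟩ := hxt
      rw [htar] at hx ⊢
      rcases eq_mid_or_succAbove i with rfl | ⟨p, rfl⟩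
      · rw [target_mid] at hx ⊢
        have hv0 : v ≠ 0 := by rintro rfl; exact hx (parent_zero k)
        exact Finset.mem_union_left _ (hpar v (hv hv0) hx)
      · rw [target_succAbove]
        exact Finset.mem_union_right _ ((hmemC _).2 ⟨p, rfl⟩)
    · rw [hrest x hxt] at hx ⊢
      exact Finset.mem_union_left _ (hocc x hx)
  · intro w hw hpw
    rcases Finset.mem_union.1 hw with h1 | h1
    · exact Finset.mem_union_left _ (hpar w h1 hpw)
    · obtain ⟨p, rfl⟩ := (hmemC w).1 h1
      rw [parent_child v p.2] at hpw ⊢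
      exact Finset.mem_union_left _ (hv hpw)
  -- Either no vertex is new, or the number of edges grows, which pays for one more step of the
  -- recursion in `vertexBound`.
  · by_cases hsub : C ⊆ T
    · rw [Finset.union_eq_left.2 hsub]; exact hbd
    · have hlt : T.card + 1 ≤ (T ∪ C).card :=
        Finset.card_lt_card (Finset.ssubset_iff_subset_ne.2 ⟨Finset.subset_union_left,
          fun he => hsub (Finset.union_eq_left.1 he.symm)⟩)
      have hle := vertexBound_mono hk hlt
      intro w hw
      rcases Finset.mem_union.1 hw with h1 | h1
      · exact (hbd w h1).trans (vertexBound_mono hk (Finset.card_le_card Finset.subset_union_left))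
      · obtain ⟨p, rfl⟩ := (hmemC w).1 h1
        refine le_trans ?_ hle
        simp only [vertexBound, child]
        have := p.2
        exact Nat.add_le_add (Nat.mul_le_mul_left k hvb) (by omega)

/-- Distinct edges own distinct chips, so the subtree has at most n edges. -/
theorem EdgesCarryChips.le_vertexBound {k : ℕ} (hk : 0 < k) {c : Config n}
    (h : EdgesCarryChips k c) (x : Fin n) : c x ≤ vertexBound k n := by
  obtain ⟨T, o, hinj, -, -, hocc, -, hbd⟩ := h
  by_cases hx : c x = 0
  · omega
  · refine (hbd _ (hocc x hx)).trans (vertexBound_mono hk ?_)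
    simpa using Finset.card_le_card_of_injOn o (t := Finset.univ) (by simp) hinj

/-- Needed because `Set.ncard` of an infinite set is 0, which would invalidate lower bounds by
injections. -/
theorem finite_stableConfigs {k : ℕ} (hk : 0 < k) [NeZero n] : (stableConfigs k n).Finite := by
  refine (Set.Finite.pi fun _ : Fin n => Set.finite_Iic (vertexBound k n)).subset ?_
  rintro c ⟨hc, -⟩ x -
  refine EdgesCarryChips.le_vertexBound hk ?_ x
  induction hc with
  | refl => exact edgesCarryChips_initial k
  | tail _ hf ih => exact ih.step hk hf

end

/-! ### Embedded subtrees and their simultaneous play -/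

section

/-- The vertex that corresponds to `v` in the subtree below the vertex `p + 1`. -/
def lift (k p : ℕ) : ℕ → ℕ
  | 0 => p + 1
  | v + 1 => child k (lift k p (v / k)) (v % k + 1)
decreasing_by exact Nat.lt_succ_of_le (Nat.div_le_self v k)

theorem lift_zero (k p : ℕ) : lift k p 0 = p + 1 := by rw [lift]

theorem lift_child {k : ℕ} (p v : ℕ) {j : ℕ} (hj : j < k) :
    lift k p (child k v (j + 1)) = child k (lift k p v) (j + 1) := by
  have h1 : (k * v + j) / k = v := by
    rw [Nat.mul_add_div (by omega), Nat.div_eq_of_lt hj, add_zero]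
  have h2 : (k * v + j) % k = j := by
    rw [Nat.mul_add_mod, Nat.mod_eq_of_lt hj]
  have h3 : child k v (j + 1) = (k * v + j) + 1 := by simp [child, add_assoc]
  rw [h3, lift, h1, h2]

theorem lift_ne_zero (k p v : ℕ) : lift k p v ≠ 0 := by
  cases v with
  | zero => simp [lift_zero]
  | succ v => rw [lift]; exact child_ne_zero _ _ _

theorem parent_lift {k : ℕ} (hk : 0 < k) (p : ℕ) {v : ℕ} (hv : v ≠ 0) :
    parent k (lift k p v) = lift k p (parent k v) := by
  obtain ⟨q, hq⟩ := exists_child hk hv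
  rw [hq, lift_child _ _ q.2, parent_child _ q.2, parent_child _ q.2]

theorem parent_lift_zero {k p : ℕ} (hp : p < k) : parent k (lift k p 0) = 0 := by
  simp [lift_zero, parent, Nat.div_eq_of_lt hp]

theorem lift_inj {k p q : ℕ} (hp : p < k) (hq : q < k) {v w : ℕ}
    (h : lift k p v = lift k q w) : p = q ∧ v = w := by
  have hk : 0 < k := by omega
  induction v using Nat.strong_induction_on generalizing w with
  | _ v ih =>
    by_cases hv : v = 0 <;> by_cases hw : w = 0
    · subst hv hw; simpa [lift_zero] using h
    · subst hv
      have := congrArg (parent k) h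
      rw [parent_lift_zero hp, parent_lift hk _ hw] at this
      exact absurd this.symm (lift_ne_zero _ _ _)
    · subst hw
      have := congrArg (parent k) h
      rw [parent_lift_zero hq, parent_lift hk _ hv] at this
      exact absurd this (lift_ne_zero _ _ _)
    · have h1 := congrArg (parent k) h
      rw [parent_lift hk _ hw, parent_lift hk _ hv] at h1
      obtain ⟨a, ha⟩ := exists_child hk hv
      obtain ⟨b, hb⟩ := exists_child hk hw
      obtain ⟨h2, h3⟩ := ih (parent k v) (by
        conv_rhs => rw [ha]
        exact lt_child hk _ _) h1
      refine ⟨h2, ?_⟩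
      rw [ha, hb, lift_child _ _ a.2, lift_child _ _ b.2, h2, h3] at h
      rw [ha, hb, h3, child_injective _ _ h]

/-- Fails at v = 0 for the median only: the self-loop of the small tree becomes the edge to the true
root. -/
theorem target_lift {k : ℕ} (hk : 0 < k) (p : ℕ) {v : ℕ} (hv : v ≠ 0) (i : Fin (k + 1)) :
    target k (lift k p v) i = lift k p (target k v i) := by
  rcases eq_mid_or_succAbove i with rfl | ⟨q, rfl⟩
  · rw [target_mid, target_mid, parent_lift hk _ hv]
  · rw [target_succAbove, target_succAbove, lift_child _ _ q.2]

variable {k n N M : ℕ}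

theorem FiresAt.lift {v : ℕ} (hk : 0 < k) (hv : v ≠ 0) {d d' : Config N} (p : ℕ)
    (h : FiresAt k v d d') :
    FiresAt k (lift k p v) (fun x => lift k p (d x)) (fun x => lift k p (d' x)) := by
  obtain ⟨t, h1, h2, h3⟩ := h
  exact ⟨t, fun i => by simp only [h1 i], fun i => by simp only [h2 i, target_lift hk p hv],
    fun x hx => by simp only [h3 x hx]⟩

/-- A firing of a vertex other than the root. -/
def FiresInner (k : ℕ) (c c' : Config n) : Prop := ∃ v ≠ 0, FiresAt k v c c'

/-- `c'` arises from `c` by a sequence of firings of which exactly `R` are firings of the root. -/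
def Plays (k : ℕ) : ℕ → Config n → Config n → Prop
  | 0, c, c' => Relation.ReflTransGen (FiresInner k) c c'
  | R + 1, c, c' => ∃ c₁ c₂, Relation.ReflTransGen (FiresInner k) c c₁ ∧ FiresAt k 0 c₁ c₂ ∧
      Plays k R c₂ c'

theorem FiresInner.reflTransGen_fires {c c' : Config n}
    (h : Relation.ReflTransGen (FiresInner k) c c') : Relation.ReflTransGen (Fires k) c c' :=
  Relation.ReflTransGen.mono (fun _ _ ⟨_, _, h⟩ => h.fires) _ _ h

theorem Plays.reflTransGen_fires {R : ℕ} {c c' : Config n} (h : Plays k R c c') :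
    Relation.ReflTransGen (Fires k) c c' := by
  induction R generalizing c with
  | zero => exact FiresInner.reflTransGen_fires h
  | succ R ih =>
    obtain ⟨c₁, c₂, h1, h2, h3⟩ := h
    exact ((FiresInner.reflTransGen_fires h1).tail h2.fires).trans (ih h3)

theorem Plays.of_inner {R : ℕ} {c c₁ c' : Config n}
    (h : Relation.ReflTransGen (FiresInner k) c c₁) (h' : Plays k R c₁ c') : Plays k R c c' := by
  cases R with
  | zero => exact Relation.ReflTransGen.trans h h'
  | succ R =>
    obtain ⟨c₂, c₃, h1, h2, h3⟩ := h'
    exact ⟨c₂, c₃, h.trans h1, h2, h3⟩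

theorem Plays.trans {R R' : ℕ} {c c₁ c' : Config n} (h : Plays k R c c₁)
    (h' : Plays k R' c₁ c') : Plays k (R + R') c c' := by
  induction R generalizing c with
  | zero => rw [zero_add]; exact Plays.of_inner h h'
  | succ R ih =>
    obtain ⟨c₂, c₃, h1, h2, h3⟩ := h
    rw [add_right_comm]
    exact ⟨c₂, c₃, h1, h2, ih h3⟩

theorem FiresAt.plays {c c' : Config n} (h : FiresAt k 0 c c') : Plays k 1 c c' :=
  ⟨c, c', .refl, h, .refl⟩

/-- The configuration in which the chip `E none` lies on the root and the chip `E (p, x)` on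
the vertex `f p x`. -/
def combine (E : Option (Fin k × Fin N) ≃ Fin M) (f : Fin k → Config N) : Config M :=
  fun x => (E.symm x).elim 0 fun q => f q.1 q.2

variable {E : Option (Fin k × Fin N) ≃ Fin M}

theorem combine_none (f : Fin k → Config N) : combine E f (E none) = 0 := by simp [combine]

theorem combine_some (f : Fin k → Config N) (p : Fin k) (x : Fin N) :
    combine E f (E (some (p, x))) = f p x := by simp [combine]

theorem equiv_cases (E : Option (Fin k × Fin N) ≃ Fin M) (x : Fin M) :
    x = E none ∨ ∃ p y, x = E (some (p, y)) := by
  rcases h : E.symm x with _ | ⟨p, y⟩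
  · left; rw [← h]; simp
  · right; exact ⟨p, y, by rw [← h]; simp⟩

/-- Each of the `k` groups of chips is listed in increasing order. -/
def GroupsIncreasing (E : Option (Fin k × Fin N) ≃ Fin M) : Prop :=
  ∀ p, StrictMono fun x => E (some (p, x))

theorem FiresAt.combine (hE : GroupsIncreasing E) {v : ℕ} {f : Fin k → Config N} {p : Fin k}
    {g : Config N} (h : FiresAt k v (f p) g) :
    FiresAt k v (combine E f) (combine E (Function.update f p g)) := by
  obtain ⟨t, h1, h2, h3⟩ := h
  refine ⟨t.trans (OrderEmbedding.ofStrictMono _ (hE p)), fun i => ?_, fun i => ?_,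
    fun x hx => ?_⟩
  · simpa [combine_some] using h1 i
  · simpa [combine_some] using h2 i
  · rcases equiv_cases E x with rfl | ⟨q, y, rfl⟩
    · rw [combine_none, combine_none]
    · rw [combine_some, combine_some]
      by_cases hq : q = p
      · subst hq
        rw [Function.update_self]
        refine h3 y fun ⟨i, hi⟩ => hx ⟨i, by simp [hi]⟩
      · rw [Function.update_of_ne hq]

theorem reflTransGen_combine_update (hE : GroupsIncreasing E) {f : Fin k → Config N} {p : Fin k}
    {g : Config N} (h : Relation.ReflTransGen (FiresInner k) (f p) g) :
    Relation.ReflTransGen (FiresInner k) (combine E f) (combine E (Function.update f p g)) := by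
  induction h with
  | refl => rw [Function.update_eq_self]
  | @tail b c _ hbc ih =>
    obtain ⟨v, hv, hf⟩ := hbc
    refine ih.tail ⟨v, hv, ?_⟩
    have := FiresAt.combine hE (f := Function.update f p b) (p := p) (g := c) (v := v)
      (by rwa [Function.update_self])
    rwa [Function.update_idem] at this

/-- Firings within one group leave the other groups fixed, so the groups can be played one after
another. -/
theorem reflTransGen_combine (hE : GroupsIncreasing E) {f g : Fin k → Config N}
    (h : ∀ p, Relation.ReflTransGen (FiresInner k) (f p) (g p)) :
    Relation.ReflTransGen (FiresInner k) (combine E f) (combine E g) := by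
  classical
  suffices H : ∀ s : Finset (Fin k), Relation.ReflTransGen (FiresInner k) (combine E f)
      (combine E (s.piecewise g f)) by simpa using H Finset.univ
  intro s
  induction s using Finset.induction_on with
  | empty => simp [Relation.ReflTransGen.refl]
  | insert p s hp ih =>
    rw [Finset.piecewise_insert]
    refine ih.trans (reflTransGen_combine_update hE ?_)
    rw [Finset.piecewise_eq_of_notMem _ _ _ hp]
    exact h p

theorem reflTransGen_lift (hk : 0 < k) (p : ℕ) {d d' : Config N}
    (h : Relation.ReflTransGen (FiresInner k) d d') :
    Relation.ReflTransGen (FiresInner k) (fun x => lift k p (d x)) (fun x => lift k p (d' x)) := by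
  induction h with
  | refl => exact .refl
  | tail _ h ih =>
    obtain ⟨v, hv, hf⟩ := h
    exact ih.tail ⟨_, lift_ne_zero _ _ _, hf.lift hk hv p⟩

/-- The configuration on the whole tree given by configurations on the subtrees below the
children of the root. -/
def graft (E : Option (Fin k × Fin N) ≃ Fin M) (d : Fin k → Config N) : Config M :=
  combine E fun p x => lift k p (d p x)

/-- In each group only the chips that can be the median of `k + 1` chips of the group matter;
those are ordered by groups, with the chip `E none` in the middle. -/
def MediansOrdered (E : Option (Fin k × Fin N) ≃ Fin M) : Prop :=
  ∀ (p : Fin k) (x : Fin N), k / 2 ≤ x → x + (k + 1) / 2 < N →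
    (p < k / 2 → E (some (p, x)) < E none) ∧ (k / 2 ≤ p → E none < E (some (p, x))) ∧
    ∀ (q : Fin k) (y : Fin N), k / 2 ≤ y → y + (k + 1) / 2 < N → p < q →
      E (some (p, x)) < E (some (q, y))

/-- The tuple itself supplies ⌊k/2⌋ chips below its median and k - ⌊k/2⌋ = ⌈k/2⌉ chips above it. -/
theorem median_bounds (t : Fin (k + 1) ↪o Fin N) :
    k / 2 ≤ t (mid k) ∧ t (mid k) + (k + 1) / 2 < N := by
  have key : ∀ a b : ℕ, ∀ (ha : a < k + 1) (hb : b < k + 1), a ≤ b →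
      (t ⟨a, ha⟩ : ℕ) + (b - a) ≤ t ⟨b, hb⟩ := by
    intro a b ha hb hab
    induction b, hab using Nat.le_induction with
    | base => simp
    | succ b hab ih =>
      have h1 := ih (by omega)
      have h2 : t ⟨b, by omega⟩ < t ⟨b + 1, hb⟩ := t.strictMono (by simp)
      rw [Fin.lt_def] at h2
      omega
  have h1 := key 0 (k / 2) (by omega) (by omega) (by omega)
  have h2 := key (k / 2) k (by omega) (by omega) (by omega)
  have h3 := (t ⟨k, by omega⟩).2
  simp only [mid]
  omega

theorem strictMono_insertNth_mid {r : Fin n} {a : Fin k → Fin n} (ha : StrictMono a)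
    (hl : ∀ p : Fin k, p < k / 2 → a p < r) (hr : ∀ p : Fin k, k / 2 ≤ p → r < a p) :
    StrictMono ((mid k).insertNth (α := fun _ => Fin n) r a) := by
  intro i j hij
  rcases eq_mid_or_succAbove i with rfl | ⟨p, rfl⟩ <;>
    rcases eq_mid_or_succAbove j with rfl | ⟨q, rfl⟩
  · exact absurd hij (lt_irrefl _)
  · simp only [Fin.insertNth_apply_same, Fin.insertNth_apply_succAbove]
    rw [Fin.lt_succAbove_iff_le_castSucc] at hij
    exact hr q hij
  · simp only [Fin.insertNth_apply_same, Fin.insertNth_apply_succAbove]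
    rw [Fin.succAbove_lt_iff_castSucc_lt] at hij
    exact hl p hij
  · simp only [Fin.insertNth_apply_succAbove]
    exact ha (Fin.succAbove_lt_succAbove_iff.1 hij)

theorem firesAt_of_median {v : ℕ} {c c' : Config n} (r : Fin n) (a : Fin k → Fin n)
    (ha : StrictMono a)
    (hl : ∀ p : Fin k, p < k / 2 → a p < r) (hr : ∀ p : Fin k, k / 2 ≤ p → r < a p)
    (hcr : c r = v) (hca : ∀ p, c (a p) = v) (hcr' : c' r = parent k v)
    (hca' : ∀ p, c' (a p) = child k v (p + 1))
    (hc : ∀ x, x ≠ r → (∀ p, x ≠ a p) → c' x = c x) : FiresAt k v c c' := by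
  set t := OrderEmbedding.ofStrictMono _ (strictMono_insertNth_mid ha hl hr) with ht
  have h1 : t (mid k) = r := Fin.insertNth_apply_same (α := fun _ => Fin n) _ _ _
  have h2 : ∀ p, t ((mid k).succAbove p) = a p :=
    Fin.insertNth_apply_succAbove (α := fun _ => Fin n) _ _ _
  refine ⟨t, fun i => ?_, fun i => ?_, fun x hx => ?_⟩
  · rcases eq_mid_or_succAbove i with rfl | ⟨p, rfl⟩
    · rw [h1, hcr]
    · rw [h2, hca]
  · rcases eq_mid_or_succAbove i with rfl | ⟨p, rfl⟩
    · rw [h1, hcr', target_mid]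
    · rw [h2, hca', target_succAbove]
  · refine hc x ?_ fun p => ?_
    · rintro rfl; exact hx ⟨_, h1⟩
    · rintro rfl; exact hx ⟨_, h2 p⟩

/-- Simulation of the self-loops: each child of the root fires once, and then the root fires its own
chip as median of the k chips that came up, returning each to its child. -/
theorem firesAt_zero_graft (hE : GroupsIncreasing E) (hE' : MediansOrdered E)
    {d d' : Fin k → Config N} (h : ∀ p, FiresAt k 0 (d p) (d' p)) :
    ∃ c, Relation.ReflTransGen (FiresInner k) (graft E d) c ∧ FiresAt k 0 c (graft E d') := by
  choose t h1 h2 h3 using h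
  -- The state just before the root fires: all subtrees are in their final state, except that the k
  -- medians lie on the root.
  refine ⟨combine E fun p => Function.update (fun x => lift k p (d' p x)) (t p (mid k)) 0,
    reflTransGen_combine hE fun p => .single ⟨lift k p 0, lift_ne_zero _ _ _, t p,
      fun i => ?_, fun i => ?_, fun x hx => ?_⟩, ?_⟩
  · simp only [h1 p i]
  · rcases eq_mid_or_succAbove i with rfl | ⟨q, rfl⟩
    · rw [target_mid, parent_lift_zero p.2, Function.update_self]
    · rw [Function.update_of_ne (by simp [Fin.succAbove_ne]), h2, target_succAbove,
        target_succAbove, lift_child _ _ q.2]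
  · rw [Function.update_of_ne (by rintro rfl; exact hx ⟨_, rfl⟩), h3 p x hx]
  · have hb := fun p => median_bounds (t p)
    refine firesAt_of_median (E none) (fun p => E (some (p, t p (mid k))))
      (fun p q hpq => (hE' p _ (hb p).1 (hb p).2).2.2 q _ (hb q).1 (hb q).2 hpq)
      (fun p => (hE' p _ (hb p).1 (hb p).2).1) (fun p => (hE' p _ (hb p).1 (hb p).2).2.1)
      (combine_none _) (fun p => ?_) ?_ (fun p => ?_) (fun x hx hx' => ?_)
    · rw [combine_some, Function.update_self]
    · rw [graft, combine_none, parent_zero]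
    · rw [graft, combine_some, h2, target_mid, parent_zero, lift_zero]
      simp [child]
    · rcases equiv_cases E x with rfl | ⟨p, y, rfl⟩
      · exact absurd rfl hx
      · rw [graft, combine_some, combine_some, Function.update_of_ne]
        rintro rfl
        exact hx' p rfl

/-- If all subtrees are played with the same number of root firings, then the root can return
every chip that it receives to the subtree the chip comes from. -/
theorem Plays.graft (hk : 0 < k) (hE : GroupsIncreasing E) (hE' : MediansOrdered E) {R : ℕ}
    {d d' : Fin k → Config N} (h : ∀ p, Plays k R (d p) (d' p)) :
    Plays k R (graft E d) (graft E d') := by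
  induction R generalizing d with
  | zero => exact reflTransGen_combine hE fun p => reflTransGen_lift hk p (h p)
  | succ R ih =>
    choose d₁ d₂ h1 h2 h3 using h
    obtain ⟨c, hc, hc'⟩ := firesAt_zero_graft hE hE' h2
    exact ⟨c, _, (reflTransGen_combine hE fun p => reflTransGen_lift hk p (h1 p)).trans hc, hc',
      ih h3⟩

/-- The root holds a single chip, and chips on a common vertex elsewhere belong to one group; as
groups are listed increasingly, a firing there would be a firing in the small tree. -/
theorem stable_graft (hk : 0 < k) (hE : GroupsIncreasing E) {d : Fin k → Config N}
    (h : ∀ p, Stable k (d p)) : Stable k (graft E d) := by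
  rintro v ⟨t, ht⟩
  have hne : (0 : Fin (k + 1)) ≠ Fin.last k := by
    rw [Ne, Fin.ext_iff]; simp; omega
  by_cases hv : v = 0
  · have h0 : ∀ i, t i = E none := by
      intro i
      rcases equiv_cases E (t i) with h1 | ⟨p, y, h1⟩
      · exact h1
      · have := ht i
        rw [h1, graft, combine_some, hv] at this
        exact absurd this (lift_ne_zero _ _ _)
    exact hne (t.injective ((h0 _).trans (h0 _).symm))
  · have h0 : ∀ i, ∃ p y, t i = E (some (p, y)) ∧ lift k p (d p y) = v := by
      intro i
      rcases equiv_cases E (t i) with h1 | ⟨p, y, h1⟩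
      · have := ht i
        rw [h1, graft, combine_none] at this
        exact absurd this.symm hv
      · have := ht i
        rw [h1, graft, combine_some] at this
        exact ⟨p, y, h1, this⟩
    choose p y h1 h2 using h0
    have h3 : ∀ i, p i = p 0 ∧ d (p i) (y i) = d (p 0) (y 0) := fun i => by
      have := lift_inj (p i).2 (p 0).2 ((h2 i).trans (h2 0).symm)
      exact ⟨Fin.ext this.1, this.2⟩
    refine h (p 0) (d (p 0) (y 0)) ⟨OrderEmbedding.ofStrictMono y fun i j hij => ?_, fun i => ?_⟩
    · have := t.strictMono hij
      rw [h1, h1, (h3 i).1, (h3 j).1] at this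
      exact (hE (p 0)).lt_iff_lt.1 this
    · have := (h3 i).2
      rw [(h3 i).1] at this
      exact this

end

/-! ### The schedule of root firings that exchanges X and Y -/

section

/-- The `j`-th smallest element of a finite set of natural numbers, counted from `0`. -/
noncomputable def entry (S : Finset ℕ) (j : ℕ) : ℕ := Nat.nth (· ∈ S) j

theorem entry_mem {S : Finset ℕ} {j : ℕ} (hj : j < S.card) : entry S j ∈ S :=
  Nat.nth_mem_of_lt_card (p := (· ∈ S)) S.finite_toSet (by simpa using hj)

theorem entry_lt {S : Finset ℕ} {i j : ℕ} (hij : i < j) (hj : j < S.card) :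
    entry S i < entry S j :=
  Nat.nth_lt_nth_of_lt_card (p := (· ∈ S)) S.finite_toSet hij (by simpa using hj)

theorem entry_inj {S : Finset ℕ} {i j : ℕ} (hi : i < S.card) (hj : j < S.card)
    (h : entry S i = entry S j) : i = j := by
  rcases lt_trichotomy i j with h1 | h1 | h1
  · exact absurd h (entry_lt h1 hj).ne
  · exact h1
  · exact absurd h (entry_lt h1 hi).ne'

/-- The chips of `X` lie below the chip `A` and those of `Y` above it; the two sets are to be
exchanged. -/
structure Exchange (h H n i A T : ℕ) (X Y : Finset ℕ) : Prop where
  h_pos : 0 < h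
  h_le : h ≤ H
  i_le : i ≤ h
  A_eq : A = h * (n + 2)
  T_eq : T = A + H * n + i
  X_sub : X ⊆ Finset.Ico (h + 1) A
  X_card : X.card = i
  Y_sub : Y ⊆ Finset.Ioo A T
  Y_card : Y.card = i

/-- The chip that the `s`-th firing of the root sends to the child `p + 1`. -/
noncomputable def schedule (h H n i A T : ℕ) (X Y : Finset ℕ) : ℕ → ℕ → ℕ
  | 0, p => if p < h then p else if p < h + i then entry X (p - h) else T + 1 + H + (p - h - i)
  | 1, p => if p < h - i then entry (Finset.Ico h A \ X) p
      else if p < h then entry Y (p - (h - i)) else T + 1 + (p - h)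
  | s + 2, p => if p < h then entry (Finset.Ico h A \ X) (h - i + (p * n + s))
      else entry (Finset.Ioc A T \ Y) ((p - h) * n + s)

theorem mul_add_lt_mul_add {n p q s t : ℕ} (hpq : p < q) (hs : s < n) :
    p * n + s < q * n + t := by
  have := Nat.mul_le_mul_right n (Nat.succ_le_of_lt hpq)
  rw [Nat.succ_mul] at this
  omega

theorem mul_add_inj {n p q s t : ℕ} (hs : s < n) (ht : t < n) (h : p * n + s = q * n + t) :
    p = q ∧ s = t := by
  rcases lt_trichotomy p q with h1 | rfl | h1
  · exact absurd h (mul_add_lt_mul_add h1 hs).ne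
  · exact ⟨rfl, by omega⟩
  · exact absurd h (mul_add_lt_mul_add h1 ht).ne'

namespace Exchange

variable {h H n i A T : ℕ} {X Y : Finset ℕ} (e : Exchange h H n i A T X Y)
include e

local notation "a" => schedule h H n i A T X Y

theorem h_lt_A : h < A := by
  rw [e.A_eq]; nlinarith [e.h_pos]

theorem card_left : (Finset.Ico h A \ X).card = h * n + (h - i) := by
  have hs : X ⊆ Finset.Ico h A :=
    e.X_sub.trans (Finset.Ico_subset_Ico_left (Nat.le_succ h))
  rw [Finset.card_sdiff_of_subset hs, e.X_card, Nat.card_Ico, e.A_eq]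
  have := e.i_le
  rw [mul_add]; omega

theorem card_right : (Finset.Ioc A T \ Y).card = H * n := by
  have hs : Y ⊆ Finset.Ioc A T := e.Y_sub.trans Finset.Ioo_subset_Ioc_self
  rw [Finset.card_sdiff_of_subset hs, e.Y_card, Nat.card_Ioc, e.T_eq]
  omega

theorem mem_X {j : ℕ} (hj : j < i) : entry X j ∈ X := entry_mem (by rwa [e.X_card])

theorem mem_Y {j : ℕ} (hj : j < i) : entry Y j ∈ Y := entry_mem (by rwa [e.Y_card])

theorem mem_left {j : ℕ} (hj : j < h * n + (h - i)) :
    entry (Finset.Ico h A \ X) j ∈ Finset.Ico h A \ X := entry_mem (by rwa [e.card_left])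

theorem mem_right {j : ℕ} (hj : j < H * n) :
    entry (Finset.Ioc A T \ Y) j ∈ Finset.Ioc A T \ Y := entry_mem (by rwa [e.card_right])

theorem row_zero (p : ℕ) :
    (p < h ∧ a 0 p = p) ∨
    (h ≤ p ∧ p < h + i ∧ a 0 p = entry X (p - h) ∧ a 0 p ∈ X ∧ h < a 0 p ∧ a 0 p < A) ∨
    (h + i ≤ p ∧ a 0 p = T + 1 + H + (p - h - i)) := by
  by_cases h1 : p < h
  · exact Or.inl ⟨h1, by simp [schedule, h1]⟩
  by_cases h2 : p < h + i
  · have h3 : a 0 p = entry X (p - h) := by simp [schedule, h1, h2]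
    have h4 := e.mem_X (j := p - h) (by omega)
    have h5 := Finset.mem_Ico.1 (e.X_sub h4)
    rw [← h3] at h4 h5
    exact Or.inr (Or.inl ⟨by omega, h2, h3, h4, by omega, h5.2⟩)
  · exact Or.inr (Or.inr ⟨by omega, by simp [schedule, h1, h2]⟩)

theorem row_one (p : ℕ) :
    (p < h - i ∧ a 1 p = entry (Finset.Ico h A \ X) p ∧ a 1 p ∉ X ∧ h ≤ a 1 p ∧ a 1 p < A) ∨
    (h - i ≤ p ∧ p < h ∧ a 1 p = entry Y (p - (h - i)) ∧ a 1 p ∈ Y ∧ A < a 1 p ∧ a 1 p < T) ∨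
    (h ≤ p ∧ a 1 p = T + 1 + (p - h)) := by
  by_cases h1 : p < h - i
  · have h3 : a 1 p = entry (Finset.Ico h A \ X) p := by simp [schedule, h1]
    have h4 := e.mem_left (j := p) (by omega)
    rw [← h3, Finset.mem_sdiff, Finset.mem_Ico] at h4
    exact Or.inl ⟨h1, h3, h4.2, h4.1.1, h4.1.2⟩
  by_cases h2 : p < h
  · have h3 : a 1 p = entry Y (p - (h - i)) := by simp [schedule, h1, h2]
    have := e.i_le
    have h4 := e.mem_Y (j := p - (h - i)) (by omega)
    have h5 := Finset.mem_Ioo.1 (e.Y_sub h4)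
    rw [← h3] at h4 h5
    exact Or.inr (Or.inl ⟨by omega, h2, h3, h4, h5.1, h5.2⟩)
  · exact Or.inr (Or.inr ⟨by omega, by simp [schedule, h1, h2]⟩)

theorem row_add_two {s : ℕ} (hs : s < n) {p : ℕ} (hp : p < h + H) :
    (p < h ∧ a (s + 2) p = entry (Finset.Ico h A \ X) (h - i + (p * n + s)) ∧
      h - i + (p * n + s) < h * n + (h - i) ∧
      a (s + 2) p ∉ X ∧ h ≤ a (s + 2) p ∧ a (s + 2) p < A) ∨
    (h ≤ p ∧ a (s + 2) p = entry (Finset.Ioc A T \ Y) ((p - h) * n + s) ∧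
      (p - h) * n + s < H * n ∧
      a (s + 2) p ∉ Y ∧ A < a (s + 2) p ∧ a (s + 2) p ≤ T) := by
  by_cases h1 : p < h
  · have h3 : a (s + 2) p = entry (Finset.Ico h A \ X) (h - i + (p * n + s)) := by
      simp [schedule, h1]
    have h0 := mul_add_lt_mul_add (t := 0) h1 hs
    have h4 := e.mem_left (j := h - i + (p * n + s)) (by omega)
    rw [← h3, Finset.mem_sdiff, Finset.mem_Ico] at h4
    exact Or.inl ⟨h1, h3, by omega, h4.2, h4.1.1, h4.1.2⟩
  · have h3 : a (s + 2) p = entry (Finset.Ioc A T \ Y) ((p - h) * n + s) := by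
      simp [schedule, h1]
    have h0 := mul_add_lt_mul_add (t := 0) (show p - h < H by omega) hs
    have h4 := e.mem_right (j := (p - h) * n + s) (by omega)
    rw [← h3, Finset.mem_sdiff, Finset.mem_Ioc] at h4
    exact Or.inr ⟨by omega, h3, by omega, h4.2, h4.1.1, h4.1.2⟩

theorem row_zero_strictMono {p q : ℕ} (hpq : p < q) : a 0 p < a 0 q := by
  have h1 : q < h + i → h ≤ p → entry X (p - h) < entry X (q - h) := fun h2 h3 =>
    entry_lt (by omega) (by rw [e.X_card]; omega)
  have := e.T_eq
  have := e.h_lt_A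
  rcases e.row_zero p with hp | hp | hp <;> rcases e.row_zero q with hq | hq | hq <;> omega

theorem row_one_strictMono {p q : ℕ} (hpq : p < q) : a 1 p < a 1 q := by
  have := e.i_le
  have h1 : q < h → h - i ≤ p → entry Y (p - (h - i)) < entry Y (q - (h - i)) := fun h2 h3 =>
    entry_lt (by omega) (by rw [e.Y_card]; omega)
  have h2 : q < h - i → entry (Finset.Ico h A \ X) p < entry (Finset.Ico h A \ X) q := fun h2 =>
    entry_lt hpq (by rw [e.card_left]; omega)
  have := e.T_eq
  rcases e.row_one p with hp | hp | hp <;> rcases e.row_one q with hq | hq | hq <;> omega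

/-- Each group gets a block of n consecutive entries, so the comparison holds across different
firings s and t; this is what orders the medians. -/
theorem row_add_two_lt {s t : ℕ} (hs : s < n) (ht : t < n) {p q : ℕ} (hpq : p < q)
    (hq : q < h + H) : a (s + 2) p < a (t + 2) q := by
  rcases e.row_add_two hs (hpq.trans hq) with hp | hp <;> rcases e.row_add_two ht hq with hq | hq
  · rw [hp.2.1, hq.2.1]
    have := mul_add_lt_mul_add (t := t) hpq hs
    exact entry_lt (by omega) (by rw [e.card_left]; omega)
  · omega
  · omega
  · rw [hp.2.1, hq.2.1]
    exact entry_lt (mul_add_lt_mul_add (by omega) hs) (by rw [e.card_right]; omega)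

theorem strictMono_row {s : ℕ} (hs : s < n + 2) {p q : ℕ} (hpq : p < q) (hq : q < h + H) :
    a s p < a s q := by
  match s, hs with
  | 0, _ => exact e.row_zero_strictMono hpq
  | 1, _ => exact e.row_one_strictMono hpq
  | s + 2, hs => exact e.row_add_two_lt (by omega) (by omega) hpq hq

theorem row_lt_ne {s t : ℕ} (hst : s < t) (ht : t < n + 2) {p q : ℕ} (hp : p < h + H)
    (hq : q < h + H) : a s p ≠ a t q := by
  have := e.T_eq
  have := e.h_lt_A
  have := e.i_le
  intro heq
  match s, t, hst, ht with
  | 0, 1, _, _ =>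
    rcases e.row_zero p with h1 | h1 | h1 <;> rcases e.row_one q with h2 | h2 | h2 <;>
      first | omega | exact h2.2.2.1 (heq ▸ h1.2.2.2.1)
  | 0, t + 2, _, ht =>
    rcases e.row_zero p with h1 | h1 | h1 <;>
      rcases e.row_add_two (s := t) (by omega) hq with h2 | h2 <;>
      first | omega | exact h2.2.2.2.1 (heq ▸ h1.2.2.2.1)
  | 1, t + 2, _, ht =>
    rcases e.row_one p with h1 | h1 | h1 <;>
      rcases e.row_add_two (s := t) (by omega) hq with h2 | h2
    · rw [h1.2.1, h2.2.1] at heq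
      have := entry_inj (by rw [e.card_left]; omega) (by rw [e.card_left]; omega) heq
      omega
    · omega
    · omega
    · exact h2.2.2.2.1 (heq ▸ h1.2.2.2.1)
    · omega
    · omega
  | s + 2, t + 2, hst, ht =>
    rcases e.row_add_two (s := s) (by omega) hp with h1 | h1 <;>
      rcases e.row_add_two (s := t) (by omega) hq with h2 | h2
    · rw [h1.2.1, h2.2.1] at heq
      have := entry_inj (by rw [e.card_left]; omega) (by rw [e.card_left]; omega) heq
      have := mul_add_inj (n := n) (by omega) (by omega) (Nat.add_left_cancel this)
      omega
    · omega
    · omega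
    · rw [h1.2.1, h2.2.1] at heq
      have := entry_inj (by rw [e.card_right]; omega) (by rw [e.card_right]; omega) heq
      have := mul_add_inj (n := n) (by omega) (by omega) this
      omega

theorem schedule_inj {s t : ℕ} (hs : s < n + 2) (ht : t < n + 2) {p q : ℕ} (hp : p < h + H)
    (hq : q < h + H) (heq : a s p = a t q) : s = t ∧ p = q := by
  rcases lt_trichotomy s t with h1 | rfl | h1
  · exact absurd heq (e.row_lt_ne h1 ht hp hq)
  · refine ⟨rfl, ?_⟩
    rcases lt_trichotomy p q with h1 | h1 | h1
    · exact absurd heq (e.strictMono_row hs h1 hq).ne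
    · exact h1
    · exact absurd heq (e.strictMono_row hs h1 hp).ne'
  · exact absurd heq.symm (e.row_lt_ne h1 hs hq hp)

theorem schedule_lt {s : ℕ} (hs : s < n + 2) {p : ℕ} (hp : p < h + H) :
    a s p < (h + H) * (n + 2) + 1 := by
  -- Above T lie just the H chips of row 1 and the H - i chips of row 0 that go to the right groups
  -- without a chip of X.
  have hM : (h + H) * (n + 2) + 1 = T + 1 + 2 * H - i := by
    rw [e.T_eq, e.A_eq]; ring_nf; omega
  have := e.T_eq
  have := e.i_le
  have := e.h_le
  match s, hs with
  | 0, _ => rcases e.row_zero p with h1 | h1 | h1 <;> omega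
  | 1, _ => rcases e.row_one p with h1 | h1 | h1 <;> omega
  | s + 2, hs => rcases e.row_add_two (s := s) (by omega) hp with h1 | h1 <;> omega

theorem schedule_ne {s : ℕ} (hs : s < n + 2) {p : ℕ} (hp : p < h + H) : a s p ≠ A := by
  have := e.T_eq
  have hA := e.h_lt_A
  match s, hs with
  | 0, _ => rcases e.row_zero p with h1 | h1 | h1 <;> omega
  | 1, _ => rcases e.row_one p with h1 | h1 | h1 <;> omega
  | s + 2, hs => rcases e.row_add_two (s := s) (by omega) hp with h1 | h1 <;> omega

/-- A chip of the group `p` that is a possible median of `h + H + 1` chips of this group. -/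
theorem median_cases {s : ℕ} (hs : s < n + 2) {p : ℕ} (hp : p < h + H)
    (h1 : ∃ t < n + 2, a t p < a s p) (h2 : ∃ t < n + 2, a s p < a t p)
    (h3 : 2 ≤ h → ∃ t < n + 2, ∃ t' < n + 2, a t p < a t' p ∧ a t' p < a s p)
    (h4 : 2 ≤ H → ∃ t < n + 2, ∃ t' < n + 2, a s p < a t p ∧ a t p < a t' p) :
    2 ≤ s ∨ (p < h ∧ a s p < A ∧ h = 1) ∨ (h ≤ p ∧ A < a s p ∧ H = 1) := by
  have hT := e.T_eq
  have hi := e.i_le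
  have hh := e.h_le
  have h0 := e.h_pos
  have hA := e.h_lt_A
  have r0 := e.row_zero p
  have r1 := e.row_one p
  have r2 : ∀ t, 2 ≤ t → t < n + 2 → (p < h ∧ h ≤ a t p ∧ a t p < A ∧
      (p < h - i → a 1 p < a t p)) ∨ (h ≤ p ∧ A < a t p ∧ a t p ≤ T) := by
    clear h1 h2 h3 h4
    intro t ht ht'
    obtain ⟨t, rfl⟩ := Nat.exists_eq_add_of_le' ht
    rcases e.row_add_two (s := t) (by omega) hp with r | r
    · refine Or.inl ⟨r.1, r.2.2.2.2.1, r.2.2.2.2.2, fun h1 => ?_⟩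
      have : a 1 p = entry (Finset.Ico h A \ X) p := by simp [schedule, h1]
      rw [this, r.2.1]
      exact entry_lt (by omega) (by rw [e.card_left]; omega)
    · exact Or.inr ⟨r.1, r.2.2.2.2.1, r.2.2.2.2.2⟩
  have r3 : ∀ t < n + 2, t = 0 ∨ t = 1 ∨ (2 ≤ t ∧ ((p < h ∧ h ≤ a t p ∧ a t p < A ∧
      (p < h - i → a 1 p < a t p)) ∨ (h ≤ p ∧ A < a t p ∧ a t p ≤ T))) := fun t ht => by
    by_cases h5 : 2 ≤ t
    · exact Or.inr (Or.inr ⟨h5, r2 t h5 ht⟩)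
    · clear h1 h2 h3 h4; omega
  obtain ⟨t₁, ht₁, h1⟩ := h1
  obtain ⟨t₂, ht₂, h2⟩ := h2
  have r₁ := r3 t₁ ht₁
  have r₂ := r3 t₂ ht₂
  rcases r3 s hs with rfl | rfl | hs2
  -- A chip of row 0 is the smallest or the largest of its group.
  · clear h3 h4
    rcases r₁ with rfl | rfl | r₁ <;> rcases r₂ with rfl | rfl | r₂ <;> omega
  -- A chip of row 1 is second smallest, largest or second largest in its group. Second from an end
  -- is excluded once h ≥ 2, respectively H ≥ 2.
  · right
    by_cases hpi : p < h - i
    · by_cases hh1 : h = 1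
      · clear h3 h4; omega
      · obtain ⟨t, ht, t', ht', h5, h6⟩ := h3 (by clear h3 h4; omega)
        clear h3 h4
        rcases r3 t ht with rfl | rfl | r <;> rcases r3 t' ht' with rfl | rfl | r' <;> omega
    · by_cases hpi' : p < h + i
      · clear h3 h4
        rcases r₂ with rfl | rfl | r₂ <;> omega
      · by_cases hH1 : H = 1
        · clear h3 h4; omega
        · obtain ⟨t, ht, t', ht', h5, h6⟩ := h4 (by clear h3 h4; omega)
          clear h3 h4
          rcases r3 t ht with rfl | rfl | r <;> rcases r3 t' ht' with rfl | rfl | r' <;> omega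
  · exact Or.inl hs2.1

theorem mem_X_iff {s : ℕ} (hs : s < n + 2) {p : ℕ} (hp : p < h + H) :
    a s p ∈ X ↔ a s p < A ∧ h ≤ p := by
  have := e.T_eq
  have := e.i_le
  have h0 : ∀ x ∈ X, h < x ∧ x < A := fun x hx => by
    have := Finset.mem_Ico.1 (e.X_sub hx); omega
  refine ⟨fun hx => ?_, fun hx => ?_⟩
  · have hx' := h0 _ hx
    refine ⟨hx'.2, ?_⟩
    by_contra hlt
    match s, hs with
    | 0, _ => rcases e.row_zero p with h1 | h1 | h1 <;> omega
    | 1, _ =>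
      rcases e.row_one p with h1 | h1 | h1
      · exact h1.2.2.1 hx
      · omega
      · omega
    | s + 2, hs =>
      rcases e.row_add_two (s := s) (by omega) hp with h1 | h1
      · exact h1.2.2.2.1 hx
      · omega
  · match s, hs with
    | 0, _ =>
      rcases e.row_zero p with h1 | h1 | h1
      · omega
      · exact h1.2.2.2.1
      · omega
    | 1, _ => rcases e.row_one p with h1 | h1 | h1 <;> omega
    | s + 2, hs => rcases e.row_add_two (s := s) (by omega) hp with h1 | h1 <;> omega

theorem mem_Y_iff {s : ℕ} (hs : s < n + 2) {p : ℕ} (hp : p < h + H) :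
    a s p ∈ Y ↔ A < a s p ∧ p < h := by
  have hT := e.T_eq
  have hi := e.i_le
  have h0 : ∀ y ∈ Y, A < y ∧ y < T := fun y hy => Finset.mem_Ioo.1 (e.Y_sub hy)
  have hA := e.h_lt_A
  refine ⟨fun hx => ?_, fun hx => ?_⟩
  · have hx' := h0 _ hx
    refine ⟨hx'.1, ?_⟩
    by_contra hlt
    match s, hs with
    | 0, _ => rcases e.row_zero p with h1 | h1 | h1 <;> omega
    | 1, _ => rcases e.row_one p with h1 | h1 | h1 <;> omega
    | s + 2, hs =>
      rcases e.row_add_two (s := s) (by omega) hp with h1 | h1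
      · omega
      · exact h1.2.2.2.1 hx
  · match s, hs with
    | 0, _ => rcases e.row_zero p with h1 | h1 | h1 <;> omega
    | 1, _ =>
      rcases e.row_one p with h1 | h1 | h1
      · omega
      · exact h1.2.2.2.1
      · omega
    | s + 2, hs => rcases e.row_add_two (s := s) (by omega) hp with h1 | h1 <;> omega

/-- The median of the `s`-th firing of the root can be chosen as a chip that has not left yet. -/
theorem exists_median (hn : 0 < n) {s : ℕ} (hs : s < n + 2) :
    ∃ m < (h + H) * (n + 2) + 1, (∀ p < h, a s p < m) ∧ (∀ p, h ≤ p → p < h + H → m < a s p) ∧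
      ∀ t ≤ s, ∀ p < h + H, a t p ≠ m := by
  have hM : (h + H) * (n + 2) + 1 = T + 1 + 2 * H - i := by
    rw [e.T_eq, e.A_eq]; ring_nf; omega
  have hT := e.T_eq
  have hi := e.i_le
  have hh := e.h_le
  have h0 := e.h_pos
  have hA := e.h_lt_A
  have hHn : 0 < H * n := Nat.mul_pos (by omega) hn
  match s, hs with
  | 0, _ =>
    -- Chip h is still on the root because X avoids it.
    refine ⟨h, by omega, fun p hp => ?_, fun p hp hp' => ?_, fun t ht p hp => ?_⟩
    · rcases e.row_zero p with h1 | h1 | h1 <;> omega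
    · rcases e.row_zero p with h1 | h1 | h1 <;> omega
    · obtain rfl : t = 0 := by omega
      rcases e.row_zero p with h1 | h1 | h1 <;> omega
  | 1, _ =>
    -- Chip T exceeds all of Y and is handed out only in a later row.
    refine ⟨T, by omega, fun p hp => ?_, fun p hp hp' => ?_, fun t ht p hp => ?_⟩
    · rcases e.row_one p with h1 | h1 | h1 <;> omega
    · rcases e.row_one p with h1 | h1 | h1 <;> omega
    · obtain rfl | rfl : t = 0 ∨ t = 1 := by omega
      · rcases e.row_zero p with h1 | h1 | h1 <;> omega
      · rcases e.row_one p with h1 | h1 | h1 <;> omega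
  | s + 2, hs =>
    refine ⟨A, by omega, fun p hp => ?_, fun p hp hp' => ?_, fun t ht p hp =>
      e.schedule_ne (by omega) hp⟩
    · rcases e.row_add_two (s := s) (p := p) (by omega) (by omega) with h1 | h1 <;> omega
    · rcases e.row_add_two (s := s) (p := p) (by omega) (by omega) with h1 | h1 <;> omega

end Exchange

end

/-! ### Admissible distributions, their number, and the induction -/

section

variable {k N M : ℕ}

/-- The median of a root firing stays put by the self-loop, so it need only be some chip not yet
sent, and it may be sent later. -/
theorem plays_of_rounds {a : Fin N → Fin k → Fin M}
    (hinj : ∀ s t p q, a s p = a t q → s = t ∧ p = q) (hmono : ∀ s, StrictMono (a s))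
    (hmed : ∀ s, ∃ m, (∀ p : Fin k, p < k / 2 → a s p < m) ∧
      (∀ p : Fin k, k / 2 ≤ p → m < a s p) ∧ ∀ t ≤ s, ∀ p, a t p ≠ m)
    {D : Config M} (hD : ∀ s p, D (a s p) = p + 1) (hD0 : ∀ x, (∀ s p, a s p ≠ x) → D x = 0) :
    Plays k N (initial M) D := by
  classical
  let C : ℕ → Config M := fun s x => if ∃ t : Fin N, t < s ∧ ∃ p, a t p = x then D x else 0
  have hC : C N = D := by
    funext x
    by_cases h : ∃ t : Fin N, t < N ∧ ∃ p, a t p = x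
    · simp only [C, if_pos h]
    · simp only [C, if_neg h]
      exact (hD0 x fun s p hx => h ⟨s, s.2, p, hx⟩).symm
  suffices H : ∀ s ≤ N, Plays k s (initial M) (C s) by rw [← hC]; exact H N le_rfl
  intro s hs
  induction s with
  | zero =>
    have : C 0 = initial M := by funext x; simp [C, initial]
    rw [this]; exact Relation.ReflTransGen.refl
  | succ s ih =>
    refine (ih (by omega)).trans (FiresAt.plays ?_)
    obtain ⟨m, h1, h2, h3⟩ := hmed ⟨s, hs⟩
    refine firesAt_of_median m (a ⟨s, hs⟩) (hmono _) h1 h2 ?_ (fun p => ?_) ?_ (fun p => ?_)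
      (fun x hx hx' => ?_)
    · refine if_neg ?_
      rintro ⟨t, ht, p, hp⟩
      exact h3 t ht.le p hp
    · refine if_neg ?_
      rintro ⟨t, ht, q, hq⟩
      have := (hinj _ _ _ _ hq).1
      subst this
      exact lt_irrefl _ ht
    · rw [parent_zero]
      refine if_neg ?_
      rintro ⟨t, ht, p, hp⟩
      exact h3 t (Nat.le_of_lt_succ ht) p hp
    · have : C (s + 1) (a ⟨s, hs⟩ p) = D (a ⟨s, hs⟩ p) :=
        if_pos ⟨⟨s, hs⟩, Nat.lt_succ_self s, p, rfl⟩
      rw [this, hD, child, mul_zero, zero_add]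
    · have : (∃ t : Fin N, t < s + 1 ∧ ∃ p, a t p = x) ↔ ∃ t : Fin N, t < s ∧ ∃ p, a t p = x := by
        refine ⟨?_, fun ⟨t, ht, hp⟩ => ⟨t, by omega, hp⟩⟩
        rintro ⟨t, ht, p, hp⟩
        refine ⟨t, ?_, p, hp⟩
        rcases Nat.lt_succ_iff_lt_or_eq.1 ht with h4 | h4
        · exact h4
        · exfalso
          have : t = ⟨s, hs⟩ := Fin.ext h4
          subst this
          exact hx' p hp.symm
      simp only [C, this]

theorem exists_groups (hM : M = k * N + 1) {a : Fin N → Fin k → Fin M}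
    (hinj : ∀ s t p q, a s p = a t q → s = t ∧ p = q) {r : Fin M} (hr : ∀ s p, a s p ≠ r) :
    ∃ E : Option (Fin k × Fin N) ≃ Fin M, GroupsIncreasing E ∧ E none = r ∧
      (∀ p x, ∃ s, E (some (p, x)) = a s p) ∧ ∀ s p, ∃ x, E (some (p, x)) = a s p := by
  classical
  have hcard : ∀ p, (Finset.univ.image fun s => a s p).card = N := fun p => by
    rw [Finset.card_image_of_injective _ fun s t h => (hinj _ _ _ _ h).1]; simp
  let g : ∀ p, Fin N ↪o Fin M := fun p =>
    (Finset.univ.image fun s => a s p).orderEmbOfFin (hcard p)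
  have hg : ∀ p, Set.range (g p) = Set.range fun s => a s p := fun p => by
    simp [g, Finset.range_orderEmbOfFin]
  have hg1 : ∀ p x, ∃ s, g p x = a s p := fun p x => by
    obtain ⟨s, hs⟩ := (hg p).subset ⟨x, rfl⟩
    exact ⟨s, hs.symm⟩
  have hg2 : ∀ s p, ∃ x, g p x = a s p := fun s p => (hg p).superset ⟨s, rfl⟩
  let F : Option (Fin k × Fin N) → Fin M := fun o => o.elim r fun q => g q.1 q.2
  have hF : Function.Injective F := by
    rintro (_ | ⟨p, x⟩) (_ | ⟨q, y⟩) h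
    · rfl
    · obtain ⟨s, hs⟩ := hg1 q y
      exact absurd (hs.symm.trans h.symm) (hr s q)
    · obtain ⟨s, hs⟩ := hg1 p x
      exact absurd (hs.symm.trans h) (hr s p)
    · obtain ⟨s, hs⟩ := hg1 p x
      obtain ⟨t, ht⟩ := hg1 q y
      obtain ⟨-, rfl⟩ := hinj s t p q (hs.symm.trans (Eq.trans h ht))
      have : x = y := (g p).injective h
      rw [this]
  have hb : Function.Bijective F :=
    (Fintype.bijective_iff_injective_and_card F).2 ⟨hF, by simp [hM]⟩
  exact ⟨Equiv.ofBijective F hb, fun p => (g p).strictMono, rfl, hg1, hg2⟩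

/-- The distributions of the chips to the root and its children that the root can produce
and for which the subtrees below the children can be played independently. -/
def admissible (k N M : ℕ) : Set (Option (Fin k × Fin N) ≃ Fin M) :=
  {E | GroupsIncreasing E ∧ MediansOrdered E ∧
    Plays k N (initial M) (graft E fun _ => initial N)}

/-- The subtree in which a chip lies reveals its group, and an increasing listing is determined by
its range. -/
theorem graft_inj {E E' : Option (Fin k × Fin N) ≃ Fin M}
    (hE : GroupsIncreasing E) (hE' : GroupsIncreasing E') {d d' : Fin k → Config N}
    (h : graft E d = graft E' d') : E = E' ∧ d = d' := by
  have key : ∀ {E E' : Option (Fin k × Fin N) ≃ Fin M} {d d' : Fin k → Config N},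
      graft E d = graft E' d' → ∀ p y, ∃ y', E (some (p, y)) = E' (some (p, y')) ∧
        d p y = d' p y' := by
    intro E E' d d' h p y
    have h1 := congrFun h (E (some (p, y)))
    rw [graft, combine_some] at h1
    rcases equiv_cases E' (E (some (p, y))) with h2 | ⟨q, z, h2⟩
    · rw [h2, graft, combine_none] at h1
      exact absurd h1 (lift_ne_zero _ _ _)
    · rw [h2, graft, combine_some] at h1
      obtain ⟨h3, h4⟩ := lift_inj p.2 q.2 h1
      obtain rfl := Fin.ext h3
      exact ⟨z, h2, h4⟩
  have h1 : ∀ p y, E (some (p, y)) = E' (some (p, y)) := by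
    intro p
    refine congrFun ((StrictMono.range_inj (hE p) (hE' p)).1 ?_)
    ext x
    constructor
    · rintro ⟨y, rfl⟩
      obtain ⟨y', h2, -⟩ := key h p y
      exact ⟨y', h2.symm⟩
    · rintro ⟨y, rfl⟩
      obtain ⟨y', h2, -⟩ := key h.symm p y
      exact ⟨y', h2.symm⟩
  constructor
  · refine Equiv.ext ?_
    rintro (_ | ⟨p, y⟩)
    · rcases equiv_cases E' (E none) with h2 | ⟨q, z, h2⟩
      · exact h2
      · rw [← h1] at h2
        exact absurd (E.injective h2) (by simp)
    · exact h1 p y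
  · funext p y
    obtain ⟨y', h2, h3⟩ := key h p y
    rw [← h1] at h2
    have := E.injective h2
    simp only [Option.some.injEq, Prod.mk.injEq, true_and] at this
    rw [h3, this]

/-- The stable configurations that can be reached with exactly `R` firings of the root. -/
def stableAfter (k R n : ℕ) : Set (Config n) := {c | Plays k R (initial n) c ∧ Stable k c}

theorem stableAfter_subset (k R n : ℕ) : stableAfter k R n ⊆ stableConfigs k n :=
  fun _ hc => ⟨hc.1.reflTransGen_fires, hc.2⟩

theorem admissible_mul_pow_le (hk : 0 < k) [NeZero M] (R : ℕ) :
    (admissible k N M).ncard * (stableAfter k R N).ncard ^ k ≤ (stableAfter k (N + R) M).ncard := by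
  have hfin : Finite (stableAfter k (N + R) M) :=
    ((finite_stableConfigs hk).subset (stableAfter_subset _ _ _)).to_subtype
  let Φ : admissible k N M × (Fin k → stableAfter k R N) → stableAfter k (N + R) M := fun q =>
    ⟨graft q.1.1 fun p => (q.2 p).1,
      q.1.2.2.2.trans (Plays.graft hk q.1.2.1 q.1.2.2.1 fun p => (q.2 p).2.1),
      stable_graft hk q.1.2.1 fun p => (q.2 p).2.2⟩
  have hΦ : Function.Injective Φ := by
    rintro ⟨E, d⟩ ⟨E', d'⟩ h
    have h0 : graft E.1 (fun p => (d p).1) = graft E'.1 (fun p => (d' p).1) :=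
      congrArg Subtype.val h
    obtain ⟨h1, h2⟩ := graft_inj E.2.1 E'.2.1 h0
    exact Prod.ext (Subtype.ext h1) (funext fun p => Subtype.ext (congrFun h2 p))
  have := Nat.card_le_card_of_injective Φ hΦ
  rwa [Nat.card_prod, Nat.card_fun, Nat.card_coe_set_eq, Nat.card_coe_set_eq,
    Nat.card_coe_set_eq, Nat.card_fin] at this

theorem Exchange.exists_admissible {n i A T : ℕ} {X Y : Finset ℕ} (hn : 0 < n)
    (e : Exchange (k / 2) ((k + 1) / 2) n i A T X Y) :
    ∃ E ∈ admissible k (n + 2) (k * (n + 2) + 1),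
      (∀ x, x ∈ X ↔ x < A ∧ ∃ p y, k / 2 ≤ p.val ∧ (E (some (p, y)) : ℕ) = x) ∧
      ∀ x, x ∈ Y ↔ A < x ∧ ∃ p y, p.val < k / 2 ∧ (E (some (p, y)) : ℕ) = x := by
  have hkk : k / 2 + (k + 1) / 2 = k := by omega
  have hlt : ∀ (s : Fin (n + 2)) (p : Fin k),
      schedule (k / 2) ((k + 1) / 2) n i A T X Y s p < k * (n + 2) + 1 := fun s p => by
    have := e.schedule_lt s.2 (p := p) (by omega)
    rwa [hkk] at this
  let a : Fin (n + 2) → Fin k → Fin (k * (n + 2) + 1) := fun s p => ⟨_, hlt s p⟩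
  have hA : A < k * (n + 2) + 1 := by
    rw [e.A_eq]
    exact Nat.lt_succ_of_le (Nat.mul_le_mul_right _ (Nat.div_le_self _ _))
  have hinj : ∀ s t p q, a s p = a t q → s = t ∧ p = q := fun s t p q h => by
    have := e.schedule_inj s.2 t.2 (p := p) (q := q) (by omega) (by omega) (congrArg Fin.val h)
    exact ⟨Fin.ext this.1, Fin.ext this.2⟩
  obtain ⟨E, hE, hEr, hE1, hE2⟩ := exists_groups rfl hinj (r := ⟨A, hA⟩) fun s p h =>
    e.schedule_ne s.2 (p := p) (by omega) (congrArg Fin.val h)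
  have hmed : ∀ s, ∃ m, (∀ p : Fin k, p < k / 2 → a s p < m) ∧
      (∀ p : Fin k, k / 2 ≤ p → m < a s p) ∧ ∀ t ≤ s, ∀ p, a t p ≠ m := by
    intro s
    obtain ⟨m, h0, h1, h2, h3⟩ := e.exists_median hn s.2
    rw [hkk] at h0
    exact ⟨⟨m, h0⟩, fun p hp => h1 p hp, fun p hp => h2 p hp (by omega),
      fun t ht p h => h3 t ht p (by omega) (congrArg Fin.val h)⟩
  have hplays : Plays k (n + 2) (initial (k * (n + 2) + 1)) (graft E fun _ => initial (n + 2)) := by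
    refine plays_of_rounds hinj
      (fun s p q hpq => e.strictMono_row s.2 hpq (by omega)) hmed (fun s p => ?_) (fun x hx => ?_)
    · obtain ⟨x, hx⟩ := hE2 s p
      rw [← hx, graft, combine_some, initial, lift_zero]
    · rcases equiv_cases E x with rfl | ⟨p, y, rfl⟩
      · rw [graft, combine_none]
      · obtain ⟨s, hs⟩ := hE1 p y
        exact absurd hs.symm (hx s p)
  have hmid : ∀ (p : Fin k) (x : Fin (n + 2)) (s : Fin (n + 2)), k / 2 ≤ x →
      x + (k + 1) / 2 < n + 2 → E (some (p, x)) = a s p →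
      2 ≤ (s : ℕ) ∨ (p < k / 2 ∧ (a s p : ℕ) < A ∧ k / 2 = 1) ∨
        (k / 2 ≤ p ∧ A < (a s p : ℕ) ∧ (k + 1) / 2 = 1) := by
    intro p x s hx hx' hs
    have h0 := e.h_pos
    have h0' := e.h_le
    have hval : ∀ y : ℕ, ∀ hy : y < n + 2, ∃ t : Fin (n + 2), E (some (p, ⟨y, hy⟩)) = a t p :=
      fun y hy => hE1 p ⟨y, hy⟩
    have hcmp : ∀ {y z : Fin (n + 2)} {t u : Fin (n + 2)}, E (some (p, y)) = a t p →
        E (some (p, z)) = a u p → y < z → (a t p : ℕ) < a u p := by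
      intro y z t u h1 h2 hyz
      rw [← Fin.lt_def, ← h1, ← h2]
      exact hE p hyz
    refine e.median_cases s.2 (p := p) (by omega) ?_ ?_ (fun h2 => ?_) (fun h2 => ?_)
    · obtain ⟨t, ht⟩ := hval 0 (by omega)
      exact ⟨t, t.2, hcmp ht hs (by rw [Fin.lt_def]; dsimp only; omega)⟩
    · obtain ⟨t, ht⟩ := hval (x + 1) (by omega)
      exact ⟨t, t.2, hcmp hs ht (by rw [Fin.lt_def]; dsimp only; omega)⟩
    · obtain ⟨t, ht⟩ := hval 0 (by omega)
      obtain ⟨u, hu⟩ := hval 1 (by omega)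
      exact ⟨t, t.2, u, u.2, hcmp ht hu (by rw [Fin.lt_def]; dsimp only; omega),
        hcmp hu hs (by rw [Fin.lt_def]; dsimp only; omega)⟩
    · obtain ⟨t, ht⟩ := hval (x + 1) (by omega)
      obtain ⟨u, hu⟩ := hval (x + 2) (by omega)
      exact ⟨t, t.2, u, u.2, hcmp hs ht (by rw [Fin.lt_def]; dsimp only; omega),
        hcmp ht hu (by rw [Fin.lt_def]; dsimp only; omega)⟩
  have hrow : ∀ (s : Fin (n + 2)) (p : Fin k), 2 ≤ (s : ℕ) →
      (p < k / 2 ∧ (a s p : ℕ) < A) ∨ (k / 2 ≤ p ∧ A < (a s p : ℕ)) := by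
    intro s p hs
    obtain ⟨s', hs'⟩ := Nat.exists_eq_add_of_le' hs
    have hval : (a s p : ℕ) = schedule (k / 2) ((k + 1) / 2) n i A T X Y (s' + 2) p := by
      simp only [a, hs']
    rcases e.row_add_two (s := s') (p := p) (by omega) (by omega) with h1 | h1
    · left; rw [hval]; exact ⟨h1.1, h1.2.2.2.2.2⟩
    · right; rw [hval]; exact ⟨h1.1, h1.2.2.2.2.1⟩
  refine ⟨E, ⟨hE, ?_, hplays⟩, fun x => ?_, fun x => ?_⟩
  · intro p x hx hx'
    obtain ⟨s, hs⟩ := hE1 p x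
    have h1 := hmid p x s hx hx' hs
    have h2 := hrow s p
    rw [hEr, hs]
    simp only [Fin.lt_def]
    refine ⟨fun h3 => by omega, fun h3 => by omega, fun q y hy hy' hpq => ?_⟩
    obtain ⟨t, ht⟩ := hE1 q y
    have h3 := hmid q y t hy hy' ht
    have h4 := hrow t q
    rw [ht]
    -- If a median comes from row 0 or 1, its side of A consists of one group only, so p and q lie
    -- on opposite sides and A separates the chips.
    by_cases h5 : 2 ≤ (s : ℕ) ∧ 2 ≤ (t : ℕ)
    · obtain ⟨s', hs'⟩ := Nat.exists_eq_add_of_le' h5.1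
      obtain ⟨t', ht'⟩ := Nat.exists_eq_add_of_le' h5.2
      have h6 := e.row_add_two_lt (s := s') (t := t') (by omega) (by omega) hpq
        (by omega)
      simpa only [a, hs', ht'] using h6
    · omega
  · constructor
    · intro hx
      have h1 := Finset.mem_Ico.1 (e.X_sub hx)
      refine ⟨h1.2, ?_⟩
      rcases equiv_cases E ⟨x, h1.2.trans hA⟩ with h2 | ⟨p, y, h2⟩
      · rw [hEr] at h2
        exact absurd (congrArg Fin.val h2) h1.2.ne
      · obtain ⟨s, hs⟩ := hE1 p y
        have h3 : x = a s p := congrArg Fin.val (h2.trans hs)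
        rw [h3] at hx
        exact ⟨p, y, ((e.mem_X_iff s.2 (by omega)).1 hx).2, (congrArg Fin.val h2).symm⟩
    · rintro ⟨hxA, p, y, hp, rfl⟩
      obtain ⟨s, hs⟩ := hE1 p y
      rw [hs] at hxA ⊢
      exact (e.mem_X_iff s.2 (by omega)).2 ⟨hxA, hp⟩
  · constructor
    · intro hx
      have h1 := Finset.mem_Ioo.1 (e.Y_sub hx)
      refine ⟨h1.1, ?_⟩
      have hxM : x < k * (n + 2) + 1 := by
        have h2 : k * (n + 2) = A + (k + 1) / 2 * (n + 2) := by
          rw [e.A_eq, ← add_mul, hkk]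
        have := e.T_eq
        have := e.i_le
        have := e.h_le
        rw [h2, mul_add]; omega
      rcases equiv_cases E ⟨x, hxM⟩ with h2 | ⟨p, y, h2⟩
      · rw [hEr] at h2
        exact absurd (congrArg Fin.val h2) h1.1.ne'
      · obtain ⟨s, hs⟩ := hE1 p y
        have h3 : x = a s p := congrArg Fin.val (h2.trans hs)
        rw [h3] at hx
        exact ⟨p, y, ((e.mem_Y_iff s.2 (by omega)).1 hx).2, (congrArg Fin.val h2).symm⟩
    · rintro ⟨hxA, p, y, hp, rfl⟩
      obtain ⟨s, hs⟩ := hE1 p y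
      rw [hs] at hxA ⊢
      exact (e.mem_Y_iff s.2 (by omega)).2 ⟨hxA, hp⟩

theorem numChips_succ (hk : 2 ≤ k) (l : ℕ) : numChips k (l + 1) = k * numChips k l + 1 := by
  simp only [numChips]
  rw [← Nat.geomSum_eq hk, ← Nat.geomSum_eq hk, geom_sum_succ]

theorem eta_le_ncard_admissible (hk : 2 ≤ k) {j n : ℕ} (hn : 0 < n)
    (hj : numChips k j = k * (n + 2) + 1) :
    eta k j ≤ (admissible k (n + 2) (k * (n + 2) + 1)).ncard := by
  set A := k / 2 * (n + 2) with hA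
  let F : Finset (Σ _ : ℕ, Finset ℕ × Finset ℕ) := (Finset.range (k / 2 + 1)).sigma fun i =>
    Finset.powersetCard i (Finset.Ico (k / 2 + 1) A) ×ˢ
      Finset.powersetCard i (Finset.Ioo A (A + (k + 1) / 2 * n + i))
  have hF : F.card = eta k j := by
    have h1 : (numChips k j - 1) * (k / 2) / k = A := by
      rw [hj, Nat.add_sub_cancel, mul_assoc, Nat.mul_div_cancel_left _ (by omega), mul_comm]
    have h2 : (numChips k j - 1) * ((k + 1) / 2) / k = (k + 1) / 2 * n + 2 * ((k + 1) / 2) := by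
      rw [hj, Nat.add_sub_cancel, mul_assoc, Nat.mul_div_cancel_left _ (by omega)]; ring
    have h3 : 0 < (k + 1) / 2 * n := Nat.mul_pos (by omega) hn
    rw [Finset.card_sigma, eta, h1, h2]
    refine Finset.sum_congr rfl fun i _ => ?_
    rw [Finset.card_product, Finset.card_powersetCard, Finset.card_powersetCard, Nat.card_Ico,
      Nat.card_Ioo]
    congr 2 <;> omega
  have hex : ∀ q : F, ∃ E : admissible k (n + 2) (k * (n + 2) + 1),
      (∀ x, x ∈ q.1.2.1 ↔ x < A ∧ ∃ p y, k / 2 ≤ p.val ∧ (E.1 (some (p, y)) : ℕ) = x) ∧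
      ∀ x, x ∈ q.1.2.2 ↔ A < x ∧ ∃ p y, p.val < k / 2 ∧ (E.1 (some (p, y)) : ℕ) = x := by
    rintro ⟨⟨i, X, Y⟩, hq⟩
    simp only [F, Finset.mem_sigma, Finset.mem_range, Finset.mem_product,
      Finset.mem_powersetCard] at hq
    obtain ⟨hi, ⟨hX, hX'⟩, hY, hY'⟩ := hq
    obtain ⟨E, hE, h⟩ := Exchange.exists_admissible hn (k := k) (i := i) (A := A)
      ⟨by omega, by omega, by omega, hA, rfl, hX, hX', hY, hY'⟩
    exact ⟨⟨E, hE⟩, h⟩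
  choose f hf using hex
  have hinj : Function.Injective f := by
    intro q q' h
    have hX : q.1.2.1 = q'.1.2.1 := Finset.ext fun x => by rw [(hf q).1, (hf q').1, h]
    have hY : q.1.2.2 = q'.1.2.2 := Finset.ext fun x => by rw [(hf q).2, (hf q').2, h]
    have hcard : ∀ q : F, q.1.2.1.card = q.1.1 := by
      rintro ⟨⟨i, X, Y⟩, hq⟩
      simp only [F, Finset.mem_sigma, Finset.mem_range, Finset.mem_product,
        Finset.mem_powersetCard] at hq
      exact hq.2.1.2
    -- The index i is recovered as the size of X.
    refine Subtype.ext (Sigma.ext ?_ (heq_of_eq (Prod.ext hX hY)))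
    rw [← hcard, ← hcard, hX]
  have := Nat.card_le_card_of_injective f hinj
  rwa [Nat.card_eq_finsetCard, Nat.card_coe_set_eq, hF] at this

/-- Base of the induction: firing all k + 1 chips once puts them on distinct vertices. -/
theorem stableAfter_one_nonempty (hk : 0 < k) : (stableAfter k 1 (k + 1)).Nonempty := by
  let t : Fin (k + 1) ↪o Fin (k + 1) := (OrderIso.refl _).toOrderEmbedding
  have hinj : ∀ i j : Fin (k + 1), target k 0 i = target k 0 j → i = j := by
    intro i j h
    rcases eq_mid_or_succAbove i with rfl | ⟨p, rfl⟩ <;>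
      rcases eq_mid_or_succAbove j with rfl | ⟨q, rfl⟩
    · rfl
    · rw [target_mid, target_succAbove, parent_zero] at h
      exact absurd h.symm (child_ne_zero _ _ _)
    · rw [target_mid, target_succAbove, parent_zero] at h
      exact absurd h (child_ne_zero _ _ _)
    · rw [target_succAbove, target_succAbove] at h
      have := child_injective _ _ h
      rw [Fin.ext (Nat.succ_injective this)]
  refine ⟨fun x => target k 0 x, FiresAt.plays ⟨t, fun _ => rfl, fun _ => rfl,
    fun x hx => absurd ⟨x, rfl⟩ hx⟩, ?_⟩
  rintro v ⟨u, hu⟩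
  have h1 := u.injective (hinj _ _ ((hu 0).trans (hu (Fin.last k)).symm))
  rw [Fin.ext_iff] at h1
  simp at h1
  omega

theorem exists_prod_eta_le (hk : 2 ≤ k) {l : ℕ} (hl : 2 ≤ l) :
    ∃ R, ∏ j ∈ Finset.Icc 3 l, eta k j ^ (k ^ (l - j)) ≤
      (stableAfter k R (numChips k l)).ncard := by
  induction l, hl using Nat.le_induction with
  | base =>
    have h2 : numChips k 2 = k + 1 := by
      rw [numChips_succ hk, numChips_succ hk]; simp [numChips]
    refine ⟨1, ?_⟩
    rw [h2, Finset.Icc_eq_empty (by omega), Finset.prod_empty, Nat.one_le_iff_ne_zero, Ne,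
      Set.ncard_eq_zero ((finite_stableConfigs (by omega)).subset (stableAfter_subset _ _ _))]
    exact (stableAfter_one_nonempty (by omega)).ne_empty
  | succ l hl ih =>
    obtain ⟨R, hR⟩ := ih
    have h3 : 3 ≤ numChips k l := by
      obtain ⟨m, rfl⟩ := Nat.exists_eq_add_of_le' hl
      rw [numChips_succ hk, numChips_succ hk]
      nlinarith [Nat.zero_le (k * numChips k m)]
    obtain ⟨n, hn⟩ := Nat.exists_eq_add_of_le' (show 2 ≤ numChips k l by omega)
    have hN := numChips_succ hk l
    rw [hn] at hN hR
    -- The n + 2 firings that distribute the chips, then one root firing per simulated round.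
    refine ⟨n + 2 + R, ?_⟩
    rw [hN]
    refine le_trans ?_ (admissible_mul_pow_le (by omega) R)
    rw [Finset.prod_Icc_succ_top (by omega), mul_comm, Nat.sub_self, pow_zero, pow_one]
    refine Nat.mul_le_mul (eta_le_ncard_admissible hk (by omega) hN) ?_
    refine le_trans (le_of_eq ?_) (Nat.pow_le_pow_left hR k)
    rw [← Finset.prod_pow]
    refine Finset.prod_congr rfl fun j hj => ?_
    rw [Finset.mem_Icc] at hj
    rw [← pow_mul, ← pow_succ, Nat.succ_sub hj.2]

end

end ChipFiring

theorem mainTheorem2 (k l : ℕ) (hk : 2 ≤ k) (hl : 3 ≤ l) :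
    ∏ j ∈ Finset.Icc 3 l, ChipFiring.eta k j ^ (k ^ (l - j)) ≤ ChipFiring.Z k l := by
  obtain ⟨R, hR⟩ := ChipFiring.exists_prod_eta_le hk (show 2 ≤ l by omega)
  obtain ⟨m, rfl⟩ := Nat.exists_eq_add_of_le' (show 1 ≤ l by omega)
  have : NeZero (ChipFiring.numChips k (m + 1)) :=
    ⟨by rw [ChipFiring.numChips_succ hk]; omega⟩
  exact hR.trans (Set.ncard_le_ncard (ChipFiring.stableAfter_subset _ _ _)
    (ChipFiring.finite_stableConfigs (by omega)))
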